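/- Let $m\ge 1$ be an integer, $n=2m+1$ and $r_n=\sec(\pi/n)$. Let $\mathcal S_n\subset\mathbb R^3$ be the $n$-gon state space, i.e. the convex hull of the points $s_k=(r_n\cos\frac{2k\pi}{n},\,r_n\sin\frac{2k\pi}{n},\,1)$, $k=1,\dots,n$. An effect is a linear functional on $\mathbb R^3$ with values in $[0,1]$ on $\mathcal S_n$; effects are identified with vectors of $\mathbb R^3$ through the Euclidean dot product, $e(s)=e\cdot s$. The unit effect is $u=(0,0,1)$, and for every integer $k$ let $$g_k=\frac{1}{1+r_n}\Big(\cos\tfrac{2k\pi}{n},\ \sin\tfrac{2k\pi}{n},\ 1\Big)\qquad(\text{so that } g_{k+n}=g_k).$$ An observable $\mathsf A$ on $\mathcal S_n$ is a family of effects $(\mathsf A_x)_{x\in\Omega_{\mathsf A}}$ indexed by a finite outcome set $\Omega_{\mathsf A}$ with $\sum_{x}\mathsf A_x=u$. An observable $\mathsf B$ is a post-processing of $\mathsf A$ if there are $\nu_{xy}\in[0,1]$ with $\sum_{y\in\Omega_{\mathsf B}}\nu_{xy}=1$ for all $x\in\Omega_{\mathsf A}$ and $\mathsf B_y=\sum_{x\in\Omega_{\mathsf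 A}}\nu_{xy}\mathsf A_x$ for all $y\in\Omega_{\mathsf B}$. Two observables are compatible if both are post-processings of one and the same observable. Let $\mathcal T_3$ be the set of the observables on $\mathcal S_n$ that are compatible with every observable on $\mathcal S_n$. Write $\operatorname{cone}(X)$ for the set of all finite nonnegative linear combinations of elements of $X$. Then an observable $\mathsf A$ on $\mathcal S_{2m+1}$ is in $\mathcal T_3$ if and only if $$\mathsf A_x\in\bigcap_{i=1}^{2m+1}\operatorname{cone}\{g_i,\,g_{i+m},\,g_{i+m+1}\}\qquad\text{for all } x\in\Omega_{\mathsf A}.$$ -/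

import Mathlib

universe u v

noncomputable section

namespace GPT

/-- A state space in a finite-dimensional real vector space `V`: a nonempty compact convex set
which is the base, cut out by the functional `unit`, of the positive cone of its nonnegative
multiples; the positive cone is generating, i.e. the set spans `V`. -/
structure StateSpace (V : Type v) [NormedAddCommGroup V] [NormedSpace ℝ V]
    [FiniteDimensional ℝ V] where
  carrier : Set V
  nonempty : carrier.Nonempty
  convex : Convex ℝ carrier
  isCompact : IsCompact carrier
  /-- The unit effect: the unique functional equal to `1` on every state. -/
  unit : Module.Dual ℝ V
  unit_apply : ∀ s ∈ carrier, unit s = 1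
  span_eq_top : Submodule.span ℝ carrier = ⊤

section General

variable {V : Type v} [NormedAddCommGroup V] [NormedSpace ℝ V] [FiniteDimensional ℝ V]

/-- The effects: linear functionals with values in `[0, 1]` on all states. -/
def StateSpace.effects (S : StateSpace V) : Set (Module.Dual ℝ V) :=
  {e | ∀ s ∈ S.carrier, 0 ≤ e s ∧ e s ≤ 1}

/-- An observable with a finite outcome set: a family of effects, indexed by the outcomes, which
sums to the unit effect. -/
structure Observable (S : StateSpace V) where
  /-- The outcome set. -/
  Outcome : Type u
  [fintypeOutcome : Fintype Outcome]
  effect : Outcome → Module.Dual ℝ V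
  effect_mem : ∀ x, effect x ∈ S.effects
  sum_effect : ∑ x, effect x = S.unit

attribute [instance] Observable.fintypeOutcome

/-- `A.PostProcessesTo B`: the observable `B` is a post-processing of `A`, that is,
`B_y = ∑ x, ν_{xy} A_x` for some right-stochastic matrix `ν`. -/
def Observable.PostProcessesTo {S : StateSpace V} (A B : Observable.{u, v} S) : Prop :=
  ∃ ν : Matrix A.Outcome B.Outcome ℝ,
    (∀ x y, 0 ≤ ν x y ∧ ν x y ≤ 1) ∧ (∀ x, ∑ y, ν x y = 1) ∧
      ∀ y, B.effect y = ∑ x, ν x y • A.effect x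

/-- Two observables are compatible if both are post-processings of a single observable. -/
def Observable.Compatible {S : StateSpace V} (A B : Observable.{u, v} S) : Prop :=
  ∃ J : Observable.{u, v} S, J.PostProcessesTo A ∧ J.PostProcessesTo B

/-- The set `T₃` of the observables that are compatible with every observable. -/
def T3 (S : StateSpace V) : Set (Observable.{u, v} S) :=
  {A | ∀ B : Observable.{u, v} S, A.Compatible B}

end General

section Polygon

/-- `r_n = sec (π / n)`. -/
def polygonRadius (n : ℕ) : ℝ := (Real.cos (Real.pi / n))⁻¹

/-- The vertex `s_k = (r_n cos (2kπ/n), r_n sin (2kπ/n), 1)`; it depends on `k` modulo `n`. -/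
def polygonVertex (n k : ℕ) : EuclideanSpace ℝ (Fin 3) :=
  !₂[polygonRadius n * Real.cos (2 * k * Real.pi / n),
    polygonRadius n * Real.sin (2 * k * Real.pi / n), 1]

/-- The functional `s ↦ e ⬝ s` (Euclidean dot product) represented by a vector `e` of `ℝ³`. -/
def dotFunctional (e : EuclideanSpace ℝ (Fin 3)) : Module.Dual ℝ (EuclideanSpace ℝ (Fin 3)) :=
  innerₗ (EuclideanSpace ℝ (Fin 3)) e

theorem dotFunctional_apply (e s : EuclideanSpace ℝ (Fin 3)) :
    dotFunctional e s = e 0 * s 0 + e 1 * s 1 + e 2 * s 2 := by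
  simp [dotFunctional, PiLp.inner_apply, Fin.sum_univ_three, mul_comm]

theorem polygonRadius_pos {n : ℕ} (hn : 3 ≤ n) : 0 < polygonRadius n := by
  have hn' : (3 : ℝ) ≤ n := by exact_mod_cast hn
  refine inv_pos.2 (Real.cos_pos_of_mem_Ioo ⟨?_, ?_⟩)
  · have : 0 < Real.pi / n := by positivity
    linarith [Real.pi_pos]
  · exact div_lt_div_of_pos_left Real.pi_pos (by norm_num) (by linarith)

theorem span_polygonVertex {n : ℕ} (hn : 3 ≤ n) :
    Submodule.span ℝ (convexHull ℝ (polygonVertex n '' Set.Icc 1 n)) = ⊤ := by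
  by_contra hne
  obtain ⟨f, hf, hle⟩ := Submodule.exists_le_ker_of_lt_top _ (lt_top_iff_ne_top.2 hne)
  have hn' : (3 : ℝ) ≤ n := by exact_mod_cast hn
  have hn0 : (n : ℝ) ≠ 0 := by positivity
  have hr := polygonRadius_pos hn
  have hθ0 : 0 < 2 * Real.pi / n := by positivity
  have hθ1 : 2 * Real.pi / n < Real.pi := by
    rw [div_lt_iff₀ (by positivity)]
    nlinarith [Real.pi_pos]
  have hsin := Real.sin_pos_of_pos_of_lt_pi hθ0 hθ1
  have hcos : Real.cos (2 * Real.pi / n) < 1 := by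
    have := Real.cos_lt_cos_of_nonneg_of_le_pi le_rfl hθ1.le hθ0
    simpa using this
  have key : ∀ k, 1 ≤ k → k ≤ n → f (polygonVertex n k) = 0 := fun k h1 h2 =>
    LinearMap.mem_ker.1 (hle (Submodule.subset_span (subset_convexHull ℝ _ ⟨k, ⟨h1, h2⟩, rfl⟩)))
  have hexp : ∀ s : EuclideanSpace ℝ (Fin 3), f s =
      s 0 * f (EuclideanSpace.single 0 1) + s 1 * f (EuclideanSpace.single 1 1) +
        s 2 * f (EuclideanSpace.single 2 1) := by
    intro s
    have hs : s = s 0 • EuclideanSpace.single (0 : Fin 3) (1 : ℝ) +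
        s 1 • EuclideanSpace.single (1 : Fin 3) (1 : ℝ) +
        s 2 • EuclideanSpace.single (2 : Fin 3) (1 : ℝ) := by
      ext i
      fin_cases i <;> simp
    conv_lhs => rw [hs]
    simp
  set a := f (EuclideanSpace.single 0 1)
  set b := f (EuclideanSpace.single 1 1)
  set c := f (EuclideanSpace.single 2 1)
  have e1 : 2 * ((n : ℕ) : ℝ) * Real.pi / n = 2 * Real.pi := by field_simp
  have e2 : 2 * ((n - 1 : ℕ) : ℝ) * Real.pi / n = 2 * Real.pi - 2 * Real.pi / n := by
    rw [Nat.cast_sub (by omega)]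
    field_simp
    simp
  have k1 := key n (by omega) le_rfl
  have k2 := key 1 le_rfl (by omega)
  have k3 := key (n - 1) (by omega) (by omega)
  rw [hexp] at k1 k2 k3
  simp only [polygonVertex, e1, e2, Nat.cast_one, mul_one, Real.cos_two_pi, Real.sin_two_pi,
    Real.cos_two_pi_sub, Real.sin_two_pi_sub] at k1 k2 k3
  simp at k1 k2 k3
  have hb : b = 0 := by
    have : (polygonRadius n * Real.sin (2 * Real.pi / n)) * b = 0 := by linarith
    exact (mul_eq_zero.1 this).resolve_left (by positivity)
  have ha : a = 0 := by
    have : (polygonRadius n * (1 - Real.cos (2 * Real.pi / n))) * a = 0 := by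
      rw [hb] at k2
      linarith
    exact (mul_eq_zero.1 this).resolve_left
      (mul_pos hr (by linarith)).ne'
  have hc : c = 0 := by
    rw [ha] at k1
    linarith
  refine hf (LinearMap.ext fun s => ?_)
  rw [hexp, ha, hb, hc]
  simp

/-- The `n`-gon state space `S_n`, the convex hull of the vertices `s_1, …, s_n` in the plane
`z = 1` of `ℝ³`, with unit effect `u = (0, 0, 1)`. -/
def polygon (n : ℕ) (hn : 3 ≤ n) : StateSpace (EuclideanSpace ℝ (Fin 3)) where
  carrier := convexHull ℝ (polygonVertex n '' Set.Icc 1 n)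
  nonempty := ⟨_, subset_convexHull ℝ _ ⟨1, ⟨le_rfl, by omega⟩, rfl⟩⟩
  convex := convex_convexHull ℝ _
  isCompact := ((Set.finite_Icc 1 n).image _).isCompact_convexHull (𝕜 := ℝ)
  unit := dotFunctional !₂[0, 0, 1]
  unit_apply := by
    intro s hs
    have hsub : convexHull ℝ (polygonVertex n '' Set.Icc 1 n) ⊆
        {s | dotFunctional !₂[0, 0, 1] s = 1} := by
      refine convexHull_min ?_ (convex_hyperplane (dotFunctional !₂[0, 0, 1]).isLinear 1)
      rintro _ ⟨k, -, rfl⟩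
      simp [dotFunctional_apply, polygonVertex]
    exact hsub hs
  span_eq_top := span_polygonVertex hn

/-- The effect `g_k = (1 + r_n)⁻¹ (cos (2kπ/n), sin (2kπ/n), 1)` (for odd `n`). -/
def g (n k : ℕ) : Module.Dual ℝ (EuclideanSpace ℝ (Fin 3)) :=
  dotFunctional ((1 / (1 + polygonRadius n)) •
    !₂[Real.cos (2 * k * Real.pi / n), Real.sin (2 * k * Real.pi / n), 1])

/-- The index of `g_k` matters only modulo `n`. -/
theorem g_add_self {n : ℕ} (hn : n ≠ 0) (k : ℕ) : g n (k + n) = g n k := by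
  have hn0 : (n : ℝ) ≠ 0 := by exact_mod_cast hn
  have h : 2 * ((k + n : ℕ) : ℝ) * Real.pi / n = 2 * k * Real.pi / n + 2 * Real.pi := by
    push_cast
    field_simp
  simp only [g, h, Real.cos_add_two_pi, Real.sin_add_two_pi]

end Polygon

end GPT

end

/-!
Compatibility with every observable is tested on observables whose effects are multiples of the
extreme rays `g_k` of the cone of positive functionals.

If `A` is compatible with all observables, take the observable with effects proportional to
`g_i`, `g_{i+m}`, `g_{i+m+1}`, whose sum is the unit effect for suitable weights. Since a positive
functional below a multiple of `g_k` is itself a multiple of `g_k`, the joint observable consists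
of multiples of these three effects, and the effects of `A`, being positive combinations of it, lie
in the cone of the triple (`effect_mem_hull_isosceles`).

Conversely, let the effects of `A` lie in all these cones. Every observable `B` is a
post-processing of one with effects `b_k g_k` (`exists_eq_sum_smul_g`), so it is enough to find
weights `w_{xk} ≥ 0` with `∑ k, w_{xk} g_k = A_x` and `∑ x, w_{xk} = b_k`
(`exists_joint_weights`). The vectors `b` for which this is possible form a convex set, so one may
assume that the `g_k` with `b_k ≠ 0` are linearly independent
(`mem_of_convex_of_linearIndepOn`). Then the second condition follows from the first by comparing
coefficients, and the first says that `A_x` lies in the cone of these `g_k`. By Farkas' lemma this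
means that `A_x` is nonnegative at each vector `v` at which these `g_k` are nonnegative. The
geometric core is `exists_isosceles_nonneg`: as these `g_k` positively combine to the unit effect,
they do not fit into an open half-plane, so the effects nonnegative at `v`, which form an arc,
include some triple `g_i`, `g_{i+m}`, `g_{i+m+1}`, and `A_x` is a positive combination of it.
-/

namespace GPT

/-! ### Finite families of vectors and functionals -/

section LinearAlgebra

/-- Moving from `b` in the direction `-c` until the first coordinate reaches zero. -/
theorem exists_sub_smul_nonneg {ι : Type*} [Fintype ι] {b c : ι → ℝ} (hb : 0 ≤ b)
    (hsupp : ∀ k, b k = 0 → c k = 0) {i : ι} (hi : 0 < c i) :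
    ∃ t : ℝ, 0 < t ∧ 0 ≤ b - t • c ∧ ∃ k, b k ≠ 0 ∧ (b - t • c) k = 0 := by
  classical
  obtain ⟨k, hk, hmin⟩ := (Finset.univ.filter fun k => 0 < c k).exists_min_image
    (fun k => b k / c k) ⟨i, by simpa using hi⟩
  have hck : 0 < c k := by simpa using hk
  have hbk : b k ≠ 0 := fun h => hck.ne' (hsupp k h)
  have hbk' : 0 < b k := lt_of_le_of_ne (hb k) hbk.symm
  refine ⟨b k / c k, by positivity, fun j => ?_, k, hbk, ?_⟩
  · simp only [Pi.zero_apply, Pi.sub_apply, Pi.smul_apply, smul_eq_mul, sub_nonneg]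
    rcases le_or_gt (c j) 0 with hj | hj
    · exact (mul_nonpos_of_nonneg_of_nonpos (by positivity) hj).trans (hb j)
    · have := hmin j (by simpa using hj)
      rwa [le_div_iff₀ hj] at this
  · simp [hck.ne']

/-- The coefficient vectors `b ≥ 0` with `∑ k, b k • g k = u` form a polytope whose vertices have
linearly independent support, so a convex set contains the polytope once it contains all such
points. The functional `φ` makes the polytope bounded. -/
theorem mem_of_convex_of_linearIndepOn {ι E : Type*} [Fintype ι] [AddCommGroup E] [Module ℝ E]
    (g : ι → E) (φ : E →ₗ[ℝ] ℝ) (hφ : ∀ k, 0 < φ (g k)) (u : E) {P : Set (ι → ℝ)}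
    (hP : Convex ℝ P)
    (base : ∀ b : ι → ℝ, 0 ≤ b → ∑ k, b k • g k = u →
      LinearIndepOn ℝ g (Finset.univ.filter fun k => b k ≠ 0 : Finset ι) → b ∈ P)
    (b : ι → ℝ) (hb : 0 ≤ b) (hu : ∑ k, b k • g k = u) : b ∈ P := by
  classical
  induction hN : (Finset.univ.filter fun k => b k ≠ 0).card using Nat.strong_induction_on
    generalizing b with
  | _ N ih =>
  by_cases hli : LinearIndepOn ℝ g (Finset.univ.filter fun k => b k ≠ 0 : Finset ι)
  · exact base b hb hu hli
  rw [linearIndepOn_finset_iff] at hli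
  push Not at hli
  obtain ⟨c₀, hc₀, i, hi, hci⟩ := hli
  obtain ⟨c, hc, hsupp, hcne⟩ : ∃ c : ι → ℝ, ∑ k, c k • g k = 0 ∧
      (∀ k, b k = 0 → c k = 0) ∧ ∃ k, c k ≠ 0 := by
    refine ⟨fun k => if b k ≠ 0 then c₀ k else 0, ?_, fun k hk => by simp [hk], i, ?_⟩
    · rw [← hc₀, Finset.sum_filter]
      exact Finset.sum_congr rfl fun k _ => by by_cases h : b k = 0 <;> simp [h]
    · have hbi : b i ≠ 0 := by simpa using hi
      simpa [hbi] using hci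
  have hsum : ∑ k, c k * φ (g k) = 0 := by
    have := congrArg φ hc
    simpa using this
  have hpos : ∃ k, 0 < c k := by
    by_contra! hneg
    obtain ⟨k, hk⟩ := hcne
    have := (Finset.sum_eq_zero_iff_of_nonpos fun k _ =>
      mul_nonpos_of_nonpos_of_nonneg (hneg k) (hφ k).le).1 hsum k (Finset.mem_univ k)
    exact (mul_ne_zero hk (hφ k).ne') this
  have hneg : ∃ k, 0 < (-c) k := by
    by_contra! hneg
    obtain ⟨k, hk⟩ := hcne
    have := (Finset.sum_eq_zero_iff_of_nonneg fun k _ =>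
      mul_nonneg (by simpa using hneg k) (hφ k).le).1 hsum k (Finset.mem_univ k)
    exact (mul_ne_zero hk (hφ k).ne') this
  -- A relation supported in the support of `b` moves `b` to a point with smaller support.
  have step : ∀ c : ι → ℝ, ∑ k, c k • g k = 0 → (∀ k, b k = 0 → c k = 0) → (∃ k, 0 < c k) →
      ∃ t : ℝ, 0 < t ∧ b - t • c ∈ P := by
    rintro c hc hsupp ⟨i, hi⟩
    obtain ⟨t, ht, hnn, k, hbk, hk⟩ := exists_sub_smul_nonneg hb hsupp hi
    refine ⟨t, ht, ih _ ?_ _ hnn ?_ rfl⟩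
    · rw [← hN]
      refine Finset.card_lt_card (Finset.ssubset_iff_of_subset ?_ |>.2 ⟨k, ?_, ?_⟩)
      · intro j hj
        simp only [Finset.mem_filter, Finset.mem_univ, true_and] at hj ⊢
        intro h
        exact hj (by simp [h, hsupp j h])
      · simpa using hbk
      · simpa using hk
    · simp only [Pi.sub_apply, Pi.smul_apply, smul_eq_mul, sub_smul, mul_smul,
        Finset.sum_sub_distrib, ← Finset.smul_sum, hc, hu, smul_zero, sub_zero]
  obtain ⟨t, ht, h₁⟩ := step c hc hsupp hpos
  obtain ⟨t', ht', h₂⟩ := step (-c) (by simp [hc]) (fun k hk => by simp [hsupp k hk]) hneg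
  have hmem := hP h₁ h₂ (a := t' / (t + t')) (b := t / (t + t')) (by positivity) (by positivity)
    (by field_simp; ring)
  convert hmem using 1
  ext k
  simp only [Pi.add_apply, Pi.smul_apply, Pi.sub_apply, Pi.neg_apply, smul_eq_mul]
  field_simp
  ring

/-- Farkas' lemma for linearly independent functionals: a functional that is nonnegative wherever
all of them are nonnegative is a nonnegative combination of them. -/
theorem exists_nonneg_sum_eq_of_linearIndependent {ι V : Type*} [Fintype ι] [AddCommGroup V]
    [Module ℝ V] {f : ι → Module.Dual ℝ V} (hf : LinearIndependent ℝ f) {e : Module.Dual ℝ V}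
    (h : ∀ v, (∀ k, 0 ≤ f k v) → 0 ≤ e v) : ∃ c : ι → ℝ, 0 ≤ c ∧ ∑ k, c k • f k = e := by
  classical
  have hspan : e ∈ Submodule.span ℝ (Set.range f) := by
    refine mem_span_of_iInf_ker_le_ker fun v hv => ?_
    simp only [Submodule.mem_iInf, LinearMap.mem_ker] at hv ⊢
    refine le_antisymm ?_ (h v fun k => (hv k).ge)
    simpa using h (-v) fun k => by simp [hv k]
  obtain ⟨c, rfl⟩ := (Submodule.mem_span_range_iff_exists_fun ℝ).1 hspan
  refine ⟨c, fun k => ?_, rfl⟩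
  -- Independence provides a vector on which only the functional `f k` does not vanish.
  obtain ⟨v, hv, hvk⟩ : ∃ v, (∀ j : {j // j ≠ k}, f j v = 0) ∧ f k v ≠ 0 := by
    by_contra! hcon
    have hmem : f k ∈ Submodule.span ℝ (Set.range fun j : {j // j ≠ k} => f j) :=
      mem_span_of_iInf_ker_le_ker fun v hv => by
        simp only [Submodule.mem_iInf, LinearMap.mem_ker] at hv ⊢
        exact hcon v hv
    refine (linearIndependent_iff_notMem_span.1 hf k) (Submodule.span_mono ?_ hmem)
    rintro _ ⟨j, rfl⟩
    exact ⟨j, by simpa using j.2, rfl⟩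
  have hval : ∀ j, f j ((f k v)⁻¹ • v) = if j = k then 1 else 0 := by
    intro j
    split_ifs with hj
    · subst hj
      simp [hvk]
    · simp [hv ⟨j, hj⟩]
  have := h ((f k v)⁻¹ • v) fun j => by rw [hval]; split_ifs <;> norm_num
  change 0 ≤ c k
  simpa only [LinearMap.sum_apply, LinearMap.smul_apply, hval, smul_eq_mul, mul_ite, mul_one,
    mul_zero, Finset.sum_ite_eq', Finset.mem_univ, if_true] using this

/-- Farkas' lemma for a linearly independent subfamily, the coefficients being extended by zero. -/
theorem exists_nonneg_sum_eq_of_linearIndepOn {ι V : Type*} [Fintype ι] [AddCommGroup V]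
    [Module ℝ V] {f : ι → Module.Dual ℝ V} {s : Finset ι} (hf : LinearIndepOn ℝ f s)
    {e : Module.Dual ℝ V} (h : ∀ v, (∀ k ∈ s, 0 ≤ f k v) → 0 ≤ e v) :
    ∃ c : ι → ℝ, 0 ≤ c ∧ (∀ k ∉ s, c k = 0) ∧ ∑ k, c k • f k = e := by
  classical
  obtain ⟨c, hc, rfl⟩ := exists_nonneg_sum_eq_of_linearIndependent (ι := s) (f := fun k => f k)
    (e := e) hf fun v hv => h v fun k hk => hv ⟨k, hk⟩
  refine ⟨fun k => if hk : k ∈ s then c ⟨k, hk⟩ else 0, fun k => ?_, fun k hk => by simp [hk], ?_⟩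
  · dsimp only
    split_ifs with hk
    · exact hc _
    · exact le_rfl
  · rw [← Finset.sum_subset (Finset.subset_univ s) fun k _ hk => by simp [hk],
      ← Finset.sum_coe_sort s]
    exact Finset.sum_congr rfl fun k _ => by simp

end LinearAlgebra

/-! ### Trigonometry of the regular polygon -/

section Angles

/-- The polar angle `2kπ/n` of the vertex `s_k` and of the effect `g_k`. -/
noncomputable def polygonAngle (n k : ℕ) : ℝ := 2 * k * Real.pi / n

theorem polygonAngle_add (n k j : ℕ) :
    polygonAngle n (k + j) = polygonAngle n k + polygonAngle n j := by
  simp only [polygonAngle]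
  push_cast
  ring

theorem polygonAngle_mono (n : ℕ) {k j : ℕ} (h : k ≤ j) :
    polygonAngle n k ≤ polygonAngle n j := by
  unfold polygonAngle
  gcongr

theorem polygonAngle_nonneg (n k : ℕ) : 0 ≤ polygonAngle n k := by
  unfold polygonAngle
  positivity

theorem polygonAngle_pos {n k : ℕ} (hn : 0 < n) (hk : 0 < k) : 0 < polygonAngle n k := by
  unfold polygonAngle
  positivity

theorem polygonAngle_eq_mod_add {n : ℕ} (hn : n ≠ 0) (k : ℕ) :
    polygonAngle n k = polygonAngle n (k % n) + (k / n : ℕ) * (2 * Real.pi) := by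
  have hn0 : (n : ℝ) ≠ 0 := by exact_mod_cast hn
  have h : (k : ℝ) = (k % n : ℕ) + n * (k / n : ℕ) := by
    exact_mod_cast (Nat.mod_add_div k n).symm
  unfold polygonAngle
  rw [h]
  field_simp

theorem cos_polygonAngle_mod {n : ℕ} (hn : n ≠ 0) (k : ℕ) :
    Real.cos (polygonAngle n (k % n)) = Real.cos (polygonAngle n k) := by
  rw [polygonAngle_eq_mod_add hn k, Real.cos_add_nat_mul_two_pi]

theorem sin_polygonAngle_mod {n : ℕ} (hn : n ≠ 0) (k : ℕ) :
    Real.sin (polygonAngle n (k % n)) = Real.sin (polygonAngle n k) := by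
  rw [polygonAngle_eq_mod_add hn k, Real.sin_add_nat_mul_two_pi]

theorem polygonAngle_half (m : ℕ) :
    polygonAngle (2 * m + 1) m = Real.pi - Real.pi / (2 * m + 1 : ℕ) := by
  unfold polygonAngle
  push_cast
  field_simp
  ring

theorem polygonAngle_half_succ (m : ℕ) :
    polygonAngle (2 * m + 1) (m + 1) = Real.pi + Real.pi / (2 * m + 1 : ℕ) := by
  unfold polygonAngle
  push_cast
  field_simp
  ring

theorem three_le_odd {m : ℕ} (hm : 1 ≤ m) : 3 ≤ 2 * m + 1 := by linarith

theorem pi_div_pos (m : ℕ) : 0 < Real.pi / (2 * m + 1 : ℕ) := by positivity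

theorem cos_pi_div_pos {m : ℕ} (hm : 1 ≤ m) : 0 < Real.cos (Real.pi / (2 * m + 1 : ℕ)) :=
  inv_pos.1 (polygonRadius_pos (n := 2 * m + 1) (three_le_odd hm))

theorem polygonRadius_mul_cos {m : ℕ} (hm : 1 ≤ m) :
    polygonRadius (2 * m + 1) * Real.cos (Real.pi / (2 * m + 1 : ℕ)) = 1 :=
  inv_mul_cancel₀ (cos_pi_div_pos hm).ne'

/-- In an odd polygon no vertex is closer to the antipode of another one than half a step. -/
theorem neg_cos_le_cos_polygonAngle_sub (m k j : ℕ) :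
    -Real.cos (Real.pi / (2 * m + 1 : ℕ)) ≤
      Real.cos (polygonAngle (2 * m + 1) k - polygonAngle (2 * m + 1) j) := by
  have hn : 2 * m + 1 ≠ 0 := by omega
  have key : ∀ d < 2 * m + 1, -Real.cos (Real.pi / (2 * m + 1 : ℕ)) ≤
      Real.cos (polygonAngle (2 * m + 1) d) := by
    intro d hd
    rw [← Real.cos_pi_sub, ← polygonAngle_half]
    have hle : polygonAngle (2 * m + 1) m ≤ Real.pi := by
      rw [polygonAngle_half]
      linarith [pi_div_pos m]
    rcases le_or_gt d m with h | h
    · exact Real.cos_le_cos_of_nonneg_of_le_pi (polygonAngle_nonneg _ _) hle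
        (polygonAngle_mono _ h)
    · rw [← Real.cos_two_pi_sub (polygonAngle (2 * m + 1) d)]
      have h1 := polygonAngle_mono (2 * m + 1) (Nat.succ_le_of_lt h)
      have h2 : polygonAngle (2 * m + 1) d ≤ 2 * Real.pi := by
        have h3 := polygonAngle_mono (2 * m + 1) hd.le
        have h4 : polygonAngle (2 * m + 1) (2 * m + 1) = 2 * Real.pi := by
          have h5 := polygonAngle_add (2 * m + 1) m (m + 1)
          rw [polygonAngle_half, polygonAngle_half_succ, ← add_assoc, ← two_mul] at h5
          rw [h5]
          ring
        linarith
      rw [Nat.succ_eq_add_one, polygonAngle_half_succ] at h1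
      rw [polygonAngle_half] at hle ⊢
      exact Real.cos_le_cos_of_nonneg_of_le_pi (by linarith) hle (by linarith)
  rw [Real.cos_sub, ← cos_polygonAngle_mod hn k, ← cos_polygonAngle_mod hn j,
    ← sin_polygonAngle_mod hn k, ← sin_polygonAngle_mod hn j, ← Real.cos_sub]
  have hk := Nat.mod_lt k (Nat.pos_of_ne_zero hn)
  have hj := Nat.mod_lt j (Nat.pos_of_ne_zero hn)
  generalize k % (2 * m + 1) = k at hk
  generalize j % (2 * m + 1) = j at hj
  rcases le_total j k with h | h
  · obtain ⟨d, rfl⟩ := Nat.exists_eq_add_of_le h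
    rw [polygonAngle_add, add_sub_cancel_left]
    exact key d (by omega)
  · obtain ⟨d, rfl⟩ := Nat.exists_eq_add_of_le h
    rw [polygonAngle_add, sub_add_cancel_left, Real.cos_neg]
    exact key d (by omega)

theorem sin_add_mul_cos (t p q : ℝ) : Real.sin (p + q) * Real.cos t =
    Real.sin q * Real.cos (t - p) + Real.sin p * Real.cos (t + q) := by
  rw [Real.sin_add, Real.cos_sub, Real.cos_add]
  ring

theorem sin_add_mul_sin (t p q : ℝ) : Real.sin (p + q) * Real.sin t =
    Real.sin q * Real.sin (t - p) + Real.sin p * Real.sin (t + q) := by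
  rw [Real.sin_add, Real.sin_sub, Real.sin_add t q]
  ring

/-- For `z ≥ 0`, the arc on which a sinusoid lies below `-z` is convex and at most a half turn. -/
theorem sinusoid_neg_of_between {x y z : ℝ} (hz : 0 ≤ z) {t p q : ℝ} (hp : 0 ≤ p) (hq : 0 ≤ q)
    (hpos : 0 < p + q) (hlt : p + q < Real.pi)
    (h₁ : Real.cos (t - p) * x + Real.sin (t - p) * y + z < 0)
    (h₂ : Real.cos (t + q) * x + Real.sin (t + q) * y + z < 0) :
    Real.cos t * x + Real.sin t * y + z < 0 := by
  have hs : 0 < Real.sin (p + q) := Real.sin_pos_of_pos_of_lt_pi hpos hlt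
  have hsp : 0 ≤ Real.sin p := Real.sin_nonneg_of_nonneg_of_le_pi hp (by linarith)
  have hsq : 0 ≤ Real.sin q := Real.sin_nonneg_of_nonneg_of_le_pi hq (by linarith)
  have hsum : Real.sin (p + q) ≤ Real.sin q + Real.sin p := by
    rw [Real.sin_add]
    nlinarith [Real.cos_le_one p, Real.cos_le_one q]
  have heq : Real.sin (p + q) * (Real.cos t * x + Real.sin t * y + z) =
      Real.sin q * (Real.cos (t - p) * x + Real.sin (t - p) * y + z) +
        Real.sin p * (Real.cos (t + q) * x + Real.sin (t + q) * y + z) -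
        (Real.sin q + Real.sin p - Real.sin (p + q)) * z := by
    linear_combination x * sin_add_mul_cos t p q + y * sin_add_mul_sin t p q
  have hneg : Real.sin (p + q) * (Real.cos t * x + Real.sin t * y + z) < 0 := by
    rw [heq]
    have h3 : 0 ≤ (Real.sin q + Real.sin p - Real.sin (p + q)) * z :=
      mul_nonneg (by linarith) hz
    rcases hsq.lt_or_eq with h | h
    · have := mul_neg_of_pos_of_neg h h₁
      have := mul_nonpos_of_nonneg_of_nonpos hsp h₂.le
      linarith
    · have := mul_neg_of_pos_of_neg (a := Real.sin p) (by linarith) h₂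
      have := mul_nonpos_of_nonneg_of_nonpos hsq h₁.le
      linarith
  exact neg_of_mul_neg_right hneg hs.le

/-- Every vector of the plane lies in a sector between two consecutive vertex directions. -/
theorem exists_polygon_sector {n : ℕ} (hn : 3 ≤ n) (x y : ℝ) :
    ∃ (k : ℕ) (α β : ℝ), 0 ≤ α ∧ 0 ≤ β ∧
      x = α * Real.cos (polygonAngle n k) + β * Real.cos (polygonAngle n (k + 1)) ∧
      y = α * Real.sin (polygonAngle n k) + β * Real.sin (polygonAngle n (k + 1)) := by
  have hn' : (3 : ℝ) ≤ n := by exact_mod_cast hn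
  set R := ‖(⟨x, y⟩ : ℂ)‖
  set φ := Complex.arg ⟨x, y⟩ + 2 * Real.pi with hφ
  have hx : R * Real.cos φ = x := by
    rw [hφ, Real.cos_add_two_pi]
    exact Complex.norm_mul_cos_arg ⟨x, y⟩
  have hy : R * Real.sin φ = y := by
    rw [hφ, Real.sin_add_two_pi]
    exact Complex.norm_mul_sin_arg ⟨x, y⟩
  have hφ0 : 0 ≤ φ := by linarith [Complex.neg_pi_lt_arg ⟨x, y⟩, Real.pi_pos]
  set δ := polygonAngle n 1 with hδ
  have hδ0 : 0 < δ := polygonAngle_pos (by omega) one_pos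
  have hδ1 : δ < Real.pi := by
    rw [hδ, polygonAngle, div_lt_iff₀ (by positivity)]
    push_cast
    nlinarith [Real.pi_pos]
  have hk1 := Nat.floor_le (a := φ / δ) (by positivity)
  have hk2 := Nat.lt_floor_add_one (φ / δ)
  set k := ⌊φ / δ⌋₊
  have hk : polygonAngle n k = k * δ := by
    simp only [hδ, polygonAngle]
    push_cast
    ring
  rw [le_div_iff₀ hδ0] at hk1
  rw [div_lt_iff₀ hδ0] at hk2
  obtain ⟨p, hp⟩ : ∃ p, p = φ - k * δ := ⟨_, rfl⟩
  have hp0 : 0 ≤ p := by linarith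
  have hp1 : 0 ≤ δ - p := by linarith
  have hs : 0 < Real.sin δ := Real.sin_pos_of_pos_of_lt_pi hδ0 hδ1
  have e1 : polygonAngle n k = φ - p := by rw [hk, hp]; ring
  have e2 : polygonAngle n (k + 1) = φ + (δ - p) := by rw [polygonAngle_add, hk, hp]; ring
  have c1 := sin_add_mul_cos φ p (δ - p)
  have c2 := sin_add_mul_sin φ p (δ - p)
  rw [add_sub_cancel] at c1 c2
  refine ⟨k, R * Real.sin (δ - p) / Real.sin δ, R * Real.sin p / Real.sin δ, ?_, ?_, ?_, ?_⟩
  · exact div_nonneg (mul_nonneg (norm_nonneg _)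
      (Real.sin_nonneg_of_nonneg_of_le_pi hp1 (by linarith))) hs.le
  · exact div_nonneg (mul_nonneg (norm_nonneg _)
      (Real.sin_nonneg_of_nonneg_of_le_pi hp0 (by linarith))) hs.le
  · rw [e1, e2, ← hx]
    field_simp
    linear_combination R * c1
  · rw [e1, e2, ← hy]
    field_simp
    linear_combination R * c2

end Angles

/-! ### The cone of positive functionals on an odd polygon -/

section Effects

theorem exists_eq_dotFunctional (f : Module.Dual ℝ (EuclideanSpace ℝ (Fin 3))) :
    ∃ x y z : ℝ, f = dotFunctional !₂[x, y, z] := by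
  refine ⟨f (EuclideanSpace.single 0 1), f (EuclideanSpace.single 1 1),
    f (EuclideanSpace.single 2 1), ?_⟩
  refine (EuclideanSpace.basisFun (Fin 3) ℝ).toBasis.ext fun i => ?_
  fin_cases i <;> simp [dotFunctional_apply]

theorem g_apply (n k : ℕ) (v : EuclideanSpace ℝ (Fin 3)) :
    g n k v = (1 / (1 + polygonRadius n)) *
      (Real.cos (polygonAngle n k) * v 0 + Real.sin (polygonAngle n k) * v 1 + v 2) := by
  simp only [g, dotFunctional_apply, polygonAngle]
  simp
  ring

theorem polygonVertex_eq (n k : ℕ) :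
    polygonVertex n k = !₂[polygonRadius n * Real.cos (polygonAngle n k),
      polygonRadius n * Real.sin (polygonAngle n k), 1] := rfl

theorem g_polygonVertex (n k j : ℕ) :
    g n k (polygonVertex n j) = (1 / (1 + polygonRadius n)) *
      (polygonRadius n * Real.cos (polygonAngle n k - polygonAngle n j) + 1) := by
  rw [g_apply, polygonVertex_eq, Real.cos_sub]
  simp only [Matrix.cons_val]
  ring

theorem g_congr {n : ℕ} (hn : n ≠ 0) {k j : ℕ} (h : k ≡ j [MOD n]) : g n k = g n j := by
  have hper : Function.Periodic (g n) n := g_add_self hn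
  rw [← hper.map_mod_nat k, ← hper.map_mod_nat j, h]

theorem polygonVertex_mem {n : ℕ} (hn : 3 ≤ n) (k : ℕ) :
    polygonVertex n k ∈ (polygon n hn).carrier := by
  have hn0 : n ≠ 0 := by omega
  -- The index set of the vertices is `1, …, n`, so residue `0` is represented by `n`.
  obtain ⟨j, hj, hjk⟩ : ∃ j ∈ Set.Icc 1 n, j % n = k % n := by
    rcases Nat.eq_zero_or_pos (k % n) with h | h
    · exact ⟨n, ⟨by omega, le_rfl⟩, by simp [h]⟩
    · exact ⟨k % n, ⟨h, (Nat.mod_lt k (by omega)).le⟩, Nat.mod_mod _ _⟩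
  have : polygonVertex n k = polygonVertex n j := by
    rw [polygonVertex_eq, polygonVertex_eq, ← cos_polygonAngle_mod hn0 k,
      ← sin_polygonAngle_mod hn0 k, ← cos_polygonAngle_mod hn0 j,
      ← sin_polygonAngle_mod hn0 j, hjk]
  rw [this]
  exact subset_convexHull ℝ _ ⟨j, hj, rfl⟩

theorem nonneg_of_nonneg_polygonVertex {n : ℕ} (hn : 3 ≤ n)
    {f : Module.Dual ℝ (EuclideanSpace ℝ (Fin 3))} (h : ∀ k, 0 ≤ f (polygonVertex n k))
    {s : EuclideanSpace ℝ (Fin 3)} (hs : s ∈ (polygon n hn).carrier) : 0 ≤ f s := by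
  refine convexHull_min (t := {s | 0 ≤ f s}) ?_ (convex_halfSpace_ge f.isLinear 0) hs
  rintro _ ⟨k, -, rfl⟩
  exact h k

theorem g_nonneg {m : ℕ} (hm : 1 ≤ m) (k : ℕ) {s : EuclideanSpace ℝ (Fin 3)}
    (hs : s ∈ (polygon (2 * m + 1) (three_le_odd hm)).carrier) :
    0 ≤ g (2 * m + 1) k s := by
  refine nonneg_of_nonneg_polygonVertex _ (fun j => ?_) hs
  have hr := polygonRadius_pos (n := 2 * m + 1) (three_le_odd hm)
  rw [g_polygonVertex]
  have h := mul_le_mul_of_nonneg_left (neg_cos_le_cos_polygonAngle_sub m k j) hr.le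
  have := polygonRadius_mul_cos hm
  exact mul_nonneg (by positivity) (by linarith)

theorem g_polygonVertex_add_half {m : ℕ} (hm : 1 ≤ m) (k : ℕ) :
    g (2 * m + 1) k (polygonVertex (2 * m + 1) (k + m)) = 0 := by
  have := polygonRadius_mul_cos hm
  rw [g_polygonVertex, polygonAngle_add, sub_add_cancel_left, Real.cos_neg, polygonAngle_half,
    Real.cos_pi_sub, mul_neg, this]
  ring

theorem g_polygonVertex_add_half_succ {m : ℕ} (hm : 1 ≤ m) (k : ℕ) :
    g (2 * m + 1) k (polygonVertex (2 * m + 1) (k + (m + 1))) = 0 := by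
  have := polygonRadius_mul_cos hm
  rw [g_polygonVertex, polygonAngle_add, sub_add_cancel_left, Real.cos_neg,
    polygonAngle_half_succ, add_comm Real.pi, Real.cos_add_pi, mul_neg, this]
  ring

/-- The unit effect as a combination of the corners of an isosceles triangle `g_i`, `g_{i+m}`,
`g_{i+m+1}`. -/
theorem unit_eq_isosceles {m : ℕ} (hm : 1 ≤ m) (i : ℕ) :
    (polygon (2 * m + 1) (three_le_odd hm)).unit = g (2 * m + 1) i +
      (polygonRadius (2 * m + 1) / 2) • g (2 * m + 1) (i + m) +
      (polygonRadius (2 * m + 1) / 2) • g (2 * m + 1) (i + m + 1) := by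
  have hr := polygonRadius_pos (n := 2 * m + 1) (three_le_odd hm)
  have hc := polygonRadius_mul_cos hm
  ext v
  simp only [LinearMap.add_apply, LinearMap.smul_apply, g_apply, smul_eq_mul, add_assoc i m 1,
    polygonAngle_add _ i, polygonAngle_half, polygonAngle_half_succ, polygon, dotFunctional_apply]
  simp only [Real.cos_add, Real.sin_add, Real.cos_pi_sub, Real.sin_pi_sub, Real.cos_pi,
    Real.sin_pi]
  simp only [Matrix.cons_val]
  field_simp
  generalize Real.cos (Real.pi / (2 * m + 1 : ℕ)) = c at *
  generalize polygonRadius (2 * m + 1) = r at *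
  linear_combination (2 * (Real.cos (polygonAngle (2 * m + 1) i) * v 0 +
    Real.sin (polygonAngle (2 * m + 1) i) * v 1)) * hc

theorem unit_mem_hull_g {m : ℕ} (hm : 1 ≤ m) :
    (polygon (2 * m + 1) (three_le_odd hm)).unit ∈
      PointedCone.hull ℝ (Set.range fun k : ℕ => g (2 * m + 1) k) := by
  have hr := polygonRadius_pos (n := 2 * m + 1) (three_le_odd hm)
  rw [unit_eq_isosceles hm 0]
  exact add_mem (add_mem (PointedCone.subset_hull ⟨_, rfl⟩)
    (PointedCone.smul_mem _ (by positivity) (PointedCone.subset_hull ⟨_, rfl⟩)))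
    (PointedCone.smul_mem _ (by positivity) (PointedCone.subset_hull ⟨_, rfl⟩))

/-- The effects `g_k` generate the cone of positive functionals. If the planar part of `f` lies
in the sector of `g_k` and `g_{k+1}`, then `f` is a combination of these two and of the unit
effect, and the coefficient of the latter is the value of `f` at their common zero
`s_{k+m+1}`. -/
theorem exists_eq_sum_smul_g {m : ℕ} (hm : 1 ≤ m)
    {f : Module.Dual ℝ (EuclideanSpace ℝ (Fin 3))}
    (hf : ∀ s ∈ (polygon (2 * m + 1) (three_le_odd hm)).carrier, 0 ≤ f s) :
    ∃ c : Fin (2 * m + 1) → ℝ, 0 ≤ c ∧ ∑ k, c k • g (2 * m + 1) k = f := by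
  have hr := polygonRadius_pos (n := 2 * m + 1) (three_le_odd hm)
  have hmem : f ∈ PointedCone.hull ℝ (Set.range fun k : ℕ => g (2 * m + 1) k) := by
    obtain ⟨x, y, z, rfl⟩ := exists_eq_dotFunctional f
    obtain ⟨k, α, β, hα, hβ, rfl, rfl⟩ :=
      exists_polygon_sector (n := 2 * m + 1) (three_le_odd hm) x y
    set x := α * Real.cos (polygonAngle (2 * m + 1) k) +
      β * Real.cos (polygonAngle (2 * m + 1) (k + 1)) with hx
    set y := α * Real.sin (polygonAngle (2 * m + 1) k) +
      β * Real.sin (polygonAngle (2 * m + 1) (k + 1)) with hy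
    set r := polygonRadius (2 * m + 1) with hr'
    have hdecomp : dotFunctional !₂[x, y, z] = (α * (1 + r)) • g (2 * m + 1) k +
        (β * (1 + r)) • g (2 * m + 1) (k + 1) +
        (z - α - β) • (polygon (2 * m + 1) (three_le_odd hm)).unit := by
      ext v
      simp only [LinearMap.add_apply, LinearMap.smul_apply, g_apply, smul_eq_mul, polygon,
        dotFunctional_apply]
      simp only [Matrix.cons_val]
      rw [hx, hy, ← hr']
      field_simp
      ring
    have hval := hf _ (polygonVertex_mem (three_le_odd hm) (k + (m + 1)))
    have h2 : g (2 * m + 1) (k + 1) (polygonVertex (2 * m + 1) (k + (m + 1))) = 0 := by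
      have := g_polygonVertex_add_half hm (k + 1)
      rwa [show k + 1 + m = k + (m + 1) by ring] at this
    rw [hdecomp] at hval ⊢
    simp only [LinearMap.add_apply, LinearMap.smul_apply, g_polygonVertex_add_half_succ hm, h2,
      (polygon (2 * m + 1) (three_le_odd hm)).unit_apply _
        (polygonVertex_mem (three_le_odd hm) (k + (m + 1))), smul_eq_mul,
      mul_zero, zero_add, mul_one] at hval
    exact add_mem (add_mem
      (PointedCone.smul_mem _ (by positivity) (PointedCone.subset_hull ⟨k, rfl⟩))
      (PointedCone.smul_mem _ (by positivity) (PointedCone.subset_hull ⟨k + 1, rfl⟩)))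
      (PointedCone.smul_mem _ hval (unit_mem_hull_g hm))
  have hrange : (Set.range fun k : ℕ => g (2 * m + 1) k) =
      Set.range fun k : Fin (2 * m + 1) => g (2 * m + 1) k := by
    refine Set.Subset.antisymm ?_ ?_
    · rintro _ ⟨k, rfl⟩
      exact ⟨⟨k % (2 * m + 1), Nat.mod_lt _ (by omega)⟩,
        g_congr (by omega) (Nat.mod_modEq k (2 * m + 1))⟩
    · rintro _ ⟨k, rfl⟩
      exact ⟨k, rfl⟩
  rw [hrange] at hmem
  obtain ⟨c, hc⟩ := (Submodule.mem_span_range_iff_exists_fun _).1 hmem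
  exact ⟨fun k => c k, fun k => (c k).2, hc⟩

/-- The ray of `g_k` is extreme: it consists of the positive functionals vanishing on the edge
opposite to the vertex `s_k`. -/
theorem eq_smul_g_of_apply_polygonVertex_eq_zero {m : ℕ} (hm : 1 ≤ m) (k : ℕ)
    {f : Module.Dual ℝ (EuclideanSpace ℝ (Fin 3))}
    (hf : ∀ s ∈ (polygon (2 * m + 1) (three_le_odd hm)).carrier, 0 ≤ f s)
    (h₁ : f (polygonVertex (2 * m + 1) (k + m)) = 0)
    (h₂ : f (polygonVertex (2 * m + 1) (k + (m + 1))) = 0) :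
    ∃ c : ℝ, 0 ≤ c ∧ f = c • g (2 * m + 1) k := by
  have hr := polygonRadius_pos (n := 2 * m + 1) (three_le_odd hm)
  have hc := polygonRadius_mul_cos hm
  have hs : 0 < Real.sin (Real.pi / (2 * m + 1 : ℕ)) :=
    Real.sin_pos_of_pos_of_lt_pi (pi_div_pos m) (div_lt_self Real.pi_pos (by
      have : (1 : ℝ) ≤ m := by exact_mod_cast hm
      push_cast
      linarith))
  have hk := hf _ (polygonVertex_mem (three_le_odd hm) k)
  obtain ⟨x, y, z, rfl⟩ := exists_eq_dotFunctional f
  rw [polygonVertex_eq] at h₁ h₂ hk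
  simp only [dotFunctional_apply, polygonAngle_add _ k, polygonAngle_half,
    polygonAngle_half_succ, Matrix.cons_val] at h₁ h₂ hk
  simp only [Real.cos_add, Real.sin_add, Real.cos_pi_sub, Real.sin_pi_sub, Real.cos_pi,
    Real.sin_pi] at h₁ h₂
  have hsq := Real.sin_sq_add_cos_sq (polygonAngle (2 * m + 1) k)
  -- In the frame rotated by the angle of `g_k`, the two zeros say that the tangential component
  -- vanishes and that the radial component equals `z`.
  have htan : -x * Real.sin (polygonAngle (2 * m + 1) k) +
      y * Real.cos (polygonAngle (2 * m + 1) k) = 0 := by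
    have : (polygonRadius (2 * m + 1) * Real.sin (Real.pi / (2 * m + 1 : ℕ)) * 2) *
        (-x * Real.sin (polygonAngle (2 * m + 1) k) +
          y * Real.cos (polygonAngle (2 * m + 1) k)) = 0 := by
      linear_combination h₁ - h₂
    exact (mul_eq_zero.1 this).resolve_left (by positivity)
  have hrad : x * Real.cos (polygonAngle (2 * m + 1) k) +
      y * Real.sin (polygonAngle (2 * m + 1) k) = z := by
    linear_combination -(h₁ + h₂) / 2 - (x * Real.cos (polygonAngle (2 * m + 1) k) +
      y * Real.sin (polygonAngle (2 * m + 1) k)) * hc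
  have hx : x = z * Real.cos (polygonAngle (2 * m + 1) k) := by
    linear_combination -x * hsq + Real.cos (polygonAngle (2 * m + 1) k) * hrad -
      Real.sin (polygonAngle (2 * m + 1) k) * htan
  have hy : y = z * Real.sin (polygonAngle (2 * m + 1) k) := by
    linear_combination -y * hsq + Real.sin (polygonAngle (2 * m + 1) k) * hrad +
      Real.cos (polygonAngle (2 * m + 1) k) * htan
  refine ⟨z * (1 + polygonRadius (2 * m + 1)), mul_nonneg ?_ (by positivity), ?_⟩
  · have : (1 + polygonRadius (2 * m + 1)) * z =
        x * (polygonRadius (2 * m + 1) * Real.cos (polygonAngle (2 * m + 1) k)) +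
        y * (polygonRadius (2 * m + 1) * Real.sin (polygonAngle (2 * m + 1) k)) + z * 1 := by
      linear_combination -polygonRadius (2 * m + 1) * hrad
    rw [← this] at hk
    exact (mul_nonneg_iff_of_pos_left (by positivity)).1 hk
  · ext v
    simp only [LinearMap.smul_apply, g_apply, smul_eq_mul, dotFunctional_apply,
      Matrix.cons_val]
    rw [hx, hy]
    field_simp

end Effects

/-! ### Isosceles triangles of indecomposable effects -/

section Triangles

/-- Effects `g_k` with a positive combination equal to the unit effect do not all point into one
open half-plane, here that of the direction `ψ`. -/
theorem exists_cos_polygonAngle_sub_nonpos {m : ℕ} (hm : 1 ≤ m) {b : Fin (2 * m + 1) → ℝ}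
    (hb : 0 ≤ b)
    (hu : ∑ k, b k • g (2 * m + 1) k = (polygon (2 * m + 1) (three_le_odd hm)).unit)
    (ψ : ℝ) : ∃ k, b k ≠ 0 ∧ Real.cos (polygonAngle (2 * m + 1) k - ψ) ≤ 0 := by
  by_contra! hcon
  have hr := polygonRadius_pos (n := 2 * m + 1) (three_le_odd hm)
  have hsum : ∑ k, b k * ((1 / (1 + polygonRadius (2 * m + 1))) *
      Real.cos (polygonAngle (2 * m + 1) k - ψ)) = 0 := by
    have h := LinearMap.congr_fun hu !₂[Real.cos ψ, Real.sin ψ, 0]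
    simp only [LinearMap.sum_apply, LinearMap.smul_apply, g_apply, smul_eq_mul, polygon,
      dotFunctional_apply, Matrix.cons_val] at h
    simp only [Real.cos_sub]
    simpa using h
  have hzero : ∀ k, b k = 0 := by
    intro k
    by_contra hk
    have h0 := (Finset.sum_eq_zero_iff_of_nonneg fun k _ => ?_).1 hsum k (Finset.mem_univ k)
    · have := hcon k hk
      exact hk ((mul_eq_zero.1 h0).resolve_right (by positivity))
    · by_cases hk : b k = 0
      · simp [hk]
      · have := hcon k hk
        have := hb k
        exact mul_nonneg this (by positivity)
  have h := LinearMap.congr_fun hu (polygonVertex (2 * m + 1) 0)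
  rw [(polygon (2 * m + 1) (three_le_odd hm)).unit_apply _
      (polygonVertex_mem (three_le_odd hm) 0)] at h
  simp [hzero] at h

/-- If the unit effect is a positive combination of effects `g_k` that are all nonnegative at `v`,
then some isosceles triangle `g_i`, `g_{i+m}`, `g_{i+m+1}` is nonnegative at `v`. Otherwise, let
`g_i` be nonnegative and `g_{i+1}` negative at `v`. The triangle with apex `g_i` shows that
`g_{i+m}` or `g_{i+m+1}` is negative, so `g_{i+1}, …, g_{i+m}` all are, and the remaining effects
lie in an open half-plane. -/
theorem exists_isosceles_nonneg {m : ℕ} (hm : 1 ≤ m) {b : Fin (2 * m + 1) → ℝ}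
    (hb : 0 ≤ b)
    (hu : ∑ k, b k • g (2 * m + 1) k = (polygon (2 * m + 1) (three_le_odd hm)).unit)
    {v : EuclideanSpace ℝ (Fin 3)} (hv : ∀ k, b k ≠ 0 → 0 ≤ g (2 * m + 1) k v) :
    ∃ i ∈ Set.Icc 1 (2 * m + 1), 0 ≤ g (2 * m + 1) i v ∧ 0 ≤ g (2 * m + 1) (i + m) v ∧
      0 ≤ g (2 * m + 1) (i + m + 1) v := by
  have hn : 2 * m + 1 ≠ 0 := by omega
  have hr := polygonRadius_pos (n := 2 * m + 1) (three_le_odd hm)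
  suffices h : ∃ i, 0 ≤ g (2 * m + 1) i v ∧ 0 ≤ g (2 * m + 1) (i + m) v ∧
      0 ≤ g (2 * m + 1) (i + m + 1) v by
    obtain ⟨i, h₁, h₂, h₃⟩ := h
    obtain ⟨j, hj, hji⟩ : ∃ j ∈ Set.Icc 1 (2 * m + 1), j ≡ i [MOD 2 * m + 1] := by
      rcases Nat.eq_zero_or_pos (i % (2 * m + 1)) with h | h
      · exact ⟨2 * m + 1, ⟨by omega, le_rfl⟩, by simp [Nat.ModEq, h]⟩
      · exact ⟨i % (2 * m + 1), ⟨h, (Nat.mod_lt i (by omega)).le⟩, Nat.mod_modEq _ _⟩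
    refine ⟨j, hj, ?_, ?_, ?_⟩
    · rwa [g_congr hn hji]
    · rwa [g_congr hn (hji.add_right m)]
    · rwa [g_congr hn ((hji.add_right m).add_right 1)]
  by_contra! hcon
  have hz : 0 ≤ v 2 := by
    have h := LinearMap.congr_fun hu v
    have h2 : (polygon (2 * m + 1) (three_le_odd hm)).unit v = v 2 := by
      simp [polygon, dotFunctional_apply]
    rw [h2] at h
    rw [← h, LinearMap.sum_apply]
    refine Finset.sum_nonneg fun k _ => ?_
    by_cases hk : b k = 0
    · simp [hk]
    · exact mul_nonneg (hb k) (hv k hk)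
  have hneg : ∀ k, g (2 * m + 1) k v < 0 ↔ Real.cos (polygonAngle (2 * m + 1) k) * v 0 +
      Real.sin (polygonAngle (2 * m + 1) k) * v 1 + v 2 < 0 := by
    intro k
    rw [g_apply]
    have : 0 < 1 / (1 + polygonRadius (2 * m + 1)) := by positivity
    exact ⟨fun h => neg_of_mul_neg_right h this.le, fun h => mul_neg_of_pos_of_neg this h⟩
  obtain ⟨i, hi, hi1⟩ : ∃ i, 0 ≤ g (2 * m + 1) i v ∧ g (2 * m + 1) (i + 1) v < 0 := by
    by_contra! hstep
    obtain ⟨k, hk, -⟩ := exists_cos_polygonAngle_sub_nonpos hm hb hu 0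
    have hall : ∀ j, 0 ≤ g (2 * m + 1) (k + j) v := by
      intro j
      induction j with
      | zero => exact hv k hk
      | succ j ih => exact hstep _ ih
    have := hcon k (hall 0) (hall m)
    exact absurd (hall (m + 1)) (not_le.2 this)
  have hrun : ∀ l ≤ m + 1, g (2 * m + 1) (i + l) v < 0 →
      ∀ j, 1 ≤ j → j ≤ l → g (2 * m + 1) (i + j) v < 0 := by
    intro l hl hgl j h1 h2
    rcases Nat.eq_or_lt_of_le h1 with rfl | h1'
    · exact hi1
    obtain ⟨p, rfl⟩ := Nat.exists_eq_add_of_le h1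
    obtain ⟨q, rfl⟩ := Nat.exists_eq_add_of_le h2
    rw [hneg] at hi1 hgl ⊢
    have hpq : polygonAngle (2 * m + 1) p + polygonAngle (2 * m + 1) q ≤
        polygonAngle (2 * m + 1) m := by
      rw [← polygonAngle_add]
      exact polygonAngle_mono _ (by omega)
    rw [polygonAngle_half] at hpq
    have hp : 0 < polygonAngle (2 * m + 1) p := polygonAngle_pos (by omega) (by omega)
    have hq := polygonAngle_nonneg (2 * m + 1) q
    refine sinusoid_neg_of_between hz hp.le hq (by linarith) (by linarith [pi_div_pos m]) ?_ ?_
    · rwa [← add_assoc, polygonAngle_add _ (i + 1), add_sub_cancel_right]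
    · rwa [← polygonAngle_add, add_assoc i (1 + p) q]
  have hrun' : ∀ j, 1 ≤ j → j ≤ m → g (2 * m + 1) (i + j) v < 0 := by
    intro j h1 h2
    by_cases h : 0 ≤ g (2 * m + 1) (i + m) v
    · exact hrun (m + 1) le_rfl (hcon i hi h) j h1 (by omega)
    · exact hrun m (by omega) (not_le.1 h) j h1 h2
  -- The effects outside the run have indices `i + j` with `m < j ≤ 2m + 1`; `ψ` is the direction
  -- in the middle of these.
  set ψ : ℝ := (2 * i + 3 * m + 2) * Real.pi / (2 * m + 1 : ℕ) with hψ
  obtain ⟨k, hk, hcos⟩ := exists_cos_polygonAngle_sub_nonpos hm hb hu ψ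
  obtain ⟨j, hj1, hj2, hjk⟩ : ∃ j, 1 ≤ j ∧ j ≤ 2 * m + 1 ∧ i + j ≡ k [MOD 2 * m + 1] := by
    refine ⟨(k + (2 * m + 1) * (i + 1) - (i + 1)) % (2 * m + 1) + 1, by omega,
      Nat.mod_lt _ (by omega), ?_⟩
    have hle : i + 1 ≤ (2 * m + 1) * (i + 1) := Nat.le_mul_of_pos_left _ (by omega)
    calc i + ((k + (2 * m + 1) * (i + 1) - (i + 1)) % (2 * m + 1) + 1)
        = (i + 1) + (k + (2 * m + 1) * (i + 1) - (i + 1)) % (2 * m + 1) := by ring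
      _ ≡ (i + 1) + (k + (2 * m + 1) * (i + 1) - (i + 1)) [MOD 2 * m + 1] :=
        (Nat.mod_modEq _ _).add_left _
      _ = k + (2 * m + 1) * (i + 1) := by omega
      _ ≡ k [MOD 2 * m + 1] := by simp [Nat.ModEq]
  have hge := hv k hk
  rw [← g_congr hn hjk] at hge
  have hjm : m + 1 ≤ j := by
    by_contra! h
    exact absurd hge (not_le.2 (hrun' j hj1 (by omega)))
  have hcos' : Real.cos (polygonAngle (2 * m + 1) k - ψ) =
      Real.cos (polygonAngle (2 * m + 1) (i + j) - ψ) := by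
    rw [Real.cos_sub, Real.cos_sub, ← cos_polygonAngle_mod hn k, ← sin_polygonAngle_mod hn k,
      ← cos_polygonAngle_mod hn (i + j), ← sin_polygonAngle_mod hn (i + j), hjk]
  rw [hcos'] at hcos
  have hdiff : polygonAngle (2 * m + 1) (i + j) - ψ =
      (2 * j - 3 * m - 2) * Real.pi / (2 * m + 1 : ℕ) := by
    rw [hψ, polygonAngle]
    push_cast
    ring
  have hj1' : (m : ℝ) + 1 ≤ j := by exact_mod_cast hjm
  have hj2' : (j : ℝ) ≤ 2 * m + 1 := by exact_mod_cast hj2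
  refine absurd hcos (not_le.2 (Real.cos_pos_of_mem_Ioo ⟨?_, ?_⟩))
  · rw [hdiff, lt_div_iff₀ (by positivity)]
    push_cast
    nlinarith [Real.pi_pos]
  · rw [hdiff, div_lt_iff₀ (by positivity)]
    push_cast
    nlinarith [Real.pi_pos]

end Triangles

/-! ### Observables and compatibility -/

section Observables

variable {V : Type v} [NormedAddCommGroup V] [NormedSpace ℝ V] [FiniteDimensional ℝ V]

/-- Positive functionals summing to the unit effect form an observable. -/
def Observable.ofNonneg {S : StateSpace V} {ι : Type u} [Fintype ι] (e : ι → Module.Dual ℝ V)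
    (he : ∀ x, ∀ s ∈ S.carrier, 0 ≤ e x s) (hsum : ∑ x, e x = S.unit) : Observable.{u, v} S where
  Outcome := ι
  effect := e
  effect_mem x s hs := by
    refine ⟨he x s hs, ?_⟩
    rw [← S.unit_apply s hs, ← hsum, LinearMap.sum_apply]
    exact Finset.single_le_sum (f := fun x => e x s) (fun y _ => he y s hs) (Finset.mem_univ x)
  sum_effect := hsum

/-- Where a positive combination of the effects of an observable vanishes, every effect that
enters it with a nonzero weight vanishes as well. -/
theorem Observable.effect_apply_eq_zero_of_sum {S : StateSpace V} (J : Observable.{u, v} S)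
    {ν : J.Outcome → ℝ} (hν : ∀ z, 0 ≤ ν z) {e : Module.Dual ℝ V}
    (he : e = ∑ z, ν z • J.effect z) {z : J.Outcome} (hz : ν z ≠ 0) {s : V} (hs : s ∈ S.carrier)
    (h : e s = 0) : J.effect z s = 0 := by
  rw [he, LinearMap.sum_apply] at h
  have := (Finset.sum_eq_zero_iff_of_nonneg fun z _ =>
    mul_nonneg (hν z) (J.effect_mem z s hs).1).1 h z (Finset.mem_univ z)
  exact (mul_eq_zero.1 this).resolve_left hz

/-- An observable compatible with every observable has its effects in every isosceles cone: the
joint observable with the trichotomic observable proportional to `g_i`, `g_{i+m}`, `g_{i+m+1}`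
consists of multiples of these three effects, as their rays are extreme. -/
theorem effect_mem_hull_isosceles {m : ℕ} (hm : 1 ≤ m)
    {A : Observable.{u, 0} (polygon (2 * m + 1) (three_le_odd hm))} (hA : A ∈ T3 _) (i : ℕ)
    (x : A.Outcome) : A.effect x ∈ PointedCone.hull ℝ
      {g (2 * m + 1) i, g (2 * m + 1) (i + m), g (2 * m + 1) (i + m + 1)} := by
  have hr := polygonRadius_pos (n := 2 * m + 1) (three_le_odd hm)
  let w : Fin 3 → ℝ := ![1, polygonRadius (2 * m + 1) / 2, polygonRadius (2 * m + 1) / 2]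
  let idx : Fin 3 → ℕ := ![i, i + m, i + m + 1]
  have hw : ∀ t, 0 ≤ w t := by
    intro t
    fin_cases t <;> simp [w] <;> positivity
  have hidx : ∀ t, g (2 * m + 1) (idx t) ∈ PointedCone.hull ℝ
      {g (2 * m + 1) i, g (2 * m + 1) (i + m), g (2 * m + 1) (i + m + 1)} := by
    intro t
    apply PointedCone.subset_hull
    fin_cases t <;> simp [idx]
  let B : Observable.{u, 0} (polygon (2 * m + 1) (three_le_odd hm)) :=
    Observable.ofNonneg (ι := ULift (Fin 3)) (fun t => w t.down • g (2 * m + 1) (idx t.down))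
      (fun t s hs => mul_nonneg (hw _) (g_nonneg hm _ hs))
      (by
        rw [unit_eq_isosceles hm i,
          ← Equiv.ulift.symm.sum_comp]
        simp [Fin.sum_univ_three, w, idx])
  obtain ⟨J, ⟨ν, hν, -, hνA⟩, ⟨ξ, hξ, hξ1, hξB⟩⟩ := hA B
  rw [hνA x]
  refine sum_mem fun z _ => PointedCone.smul_mem _ (hν z x).1 ?_
  obtain ⟨t, ht⟩ : ∃ t, ξ z t ≠ 0 := by
    by_contra! h
    have := hξ1 z
    simp [h] at this
  have hvan : ∀ k, g (2 * m + 1) (idx t.down) (polygonVertex (2 * m + 1) k) = 0 →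
      J.effect z (polygonVertex (2 * m + 1) k) = 0 := by
    intro k hk
    refine J.effect_apply_eq_zero_of_sum (fun z => (hξ z t).1) (hξB t) ht
      (polygonVertex_mem (three_le_odd hm) k) ?_
    change w t.down * g (2 * m + 1) (idx t.down) (polygonVertex (2 * m + 1) k) = 0
    rw [hk, mul_zero]
  obtain ⟨c, hc, hJ⟩ := eq_smul_g_of_apply_polygonVertex_eq_zero hm (idx t.down)
    (fun s hs => (J.effect_mem z s hs).1) (hvan _ (g_polygonVertex_add_half hm _))
    (hvan _ (g_polygonVertex_add_half_succ hm _))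
  rw [hJ]
  exact PointedCone.smul_mem _ hc (hidx _)

/-- If the effects of `A` lie in all isosceles cones, every observable with effects proportional
to `g_1, …, g_n` has a joint observable with `A`, whose effects are again proportional to the
`g_k`. The set of weights `b` admitting one is convex, so the `g_k` in use may be assumed linearly
independent. Then Farkas' lemma puts the effects of `A` into the cone of these `g_k`. -/
theorem exists_joint_weights {m : ℕ} (hm : 1 ≤ m)
    (A : Observable.{u, 0} (polygon (2 * m + 1) (three_le_odd hm)))
    (hA : ∀ x, ∀ i ∈ Set.Icc 1 (2 * m + 1), A.effect x ∈ PointedCone.hull ℝ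
      {g (2 * m + 1) i, g (2 * m + 1) (i + m), g (2 * m + 1) (i + m + 1)})
    (b : Fin (2 * m + 1) → ℝ) (hb : 0 ≤ b)
    (hu : ∑ k, b k • g (2 * m + 1) k = (polygon (2 * m + 1) (three_le_odd hm)).unit) :
    ∃ w : A.Outcome → Fin (2 * m + 1) → ℝ, 0 ≤ w ∧
      (∀ x, ∑ k, w x k • g (2 * m + 1) k = A.effect x) ∧ ∀ k, ∑ x, w x k = b k := by
  have hr := polygonRadius_pos (n := 2 * m + 1) (three_le_odd hm)
  refine mem_of_convex_of_linearIndepOn (P := {b | ∃ w : A.Outcome → Fin (2 * m + 1) → ℝ, 0 ≤ w ∧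
      (∀ x, ∑ k, w x k • g (2 * m + 1) k = A.effect x) ∧ ∀ k, ∑ x, w x k = b k})
    (fun k : Fin (2 * m + 1) => g (2 * m + 1) k) (LinearMap.applyₗ !₂[0, 0, 1])
    (fun k => ?_) _ ?_ ?_ b hb hu
  · rw [LinearMap.applyₗ_apply_apply, g_apply]
    simp
    positivity
  · rintro b₁ ⟨w₁, hw₁, hA₁, hb₁⟩ b₂ ⟨w₂, hw₂, hA₂, hb₂⟩ p q hp hq hpq
    refine ⟨p • w₁ + q • w₂, add_nonneg (smul_nonneg hp hw₁) (smul_nonneg hq hw₂), fun x => ?_,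
      fun k => ?_⟩
    · simp only [Pi.add_apply, Pi.smul_apply, add_smul, smul_assoc, Finset.sum_add_distrib,
        ← Finset.smul_sum, hA₁, hA₂]
      rw [← add_smul, hpq, one_smul]
    · simp only [Pi.add_apply, Pi.smul_apply, smul_eq_mul, Finset.sum_add_distrib,
        ← Finset.mul_sum, hb₁, hb₂]
  · intro b hb hu hli
    have hcone : ∀ x, ∃ c : Fin (2 * m + 1) → ℝ, 0 ≤ c ∧
        (∀ k ∉ Finset.univ.filter fun k => b k ≠ 0, c k = 0) ∧
        ∑ k, c k • g (2 * m + 1) k = A.effect x := by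
      intro x
      refine exists_nonneg_sum_eq_of_linearIndepOn hli fun v hv => ?_
      obtain ⟨i, hi, h₁, h₂, h₃⟩ :=
        exists_isosceles_nonneg hm hb hu (v := v) fun k hk => hv k (by simpa using hk)
      obtain ⟨c₁, c₂, c₃, h⟩ := Submodule.mem_span_triple.1 (hA x i hi)
      rw [← h]
      exact add_nonneg (add_nonneg (mul_nonneg c₁.2 h₁) (mul_nonneg c₂.2 h₂))
        (mul_nonneg c₃.2 h₃)
    choose w hw hws hwA using hcone
    refine ⟨w, hw, hwA, fun k => ?_⟩
    by_cases hk : k ∈ Finset.univ.filter fun k => b k ≠ 0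
    · have hzero : ∑ k : Fin (2 * m + 1), (∑ x, w x k - b k) • g (2 * m + 1) k = 0 := by
        have hstep : ∀ k : Fin (2 * m + 1), (∑ x, w x k - b k) • g (2 * m + 1) k =
            ∑ x, w x k • g (2 * m + 1) k - b k • g (2 * m + 1) k := fun k => by
          rw [← Finset.sum_smul]
          exact sub_smul (∑ x, w x k) (b k) (g (2 * m + 1) k)
        rw [Finset.sum_congr rfl fun k _ => hstep k, Finset.sum_sub_distrib, hu, Finset.sum_comm,
          Finset.sum_congr rfl fun x _ => hwA x, A.sum_effect, sub_self]
      rw [← Finset.sum_subset (Finset.subset_univ (Finset.univ.filter fun k => b k ≠ 0))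
        fun k _ hk => by
          have hbk : b k = 0 := by simpa using hk
          simp [hbk, hws _ k hk]] at hzero
      exact sub_eq_zero.1 (linearIndepOn_finset_iff.1 hli _ hzero k hk)
    · have hbk : b k = 0 := by simpa using hk
      simp [hbk, hws _ k hk]

/-- An observable with effects in all isosceles cones is compatible with every observable `B`:
splitting the effects of `B` into multiples of the `g_k` and collecting the multiples of each
`g_k` refines `B` to an observable with effects proportional to the `g_k`. -/
theorem mem_T3_of_effect_mem_hull_isosceles {m : ℕ} (hm : 1 ≤ m)
    (A : Observable.{u, 0} (polygon (2 * m + 1) (three_le_odd hm)))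
    (hA : ∀ x, ∀ i ∈ Set.Icc 1 (2 * m + 1), A.effect x ∈ PointedCone.hull ℝ
      {g (2 * m + 1) i, g (2 * m + 1) (i + m), g (2 * m + 1) (i + m + 1)}) :
    A ∈ T3 _ := by
  classical
  intro B
  have hB : ∀ y, ∃ c : Fin (2 * m + 1) → ℝ, 0 ≤ c ∧
      ∑ k, c k • g (2 * m + 1) k = B.effect y := fun y =>
    exists_eq_sum_smul_g hm fun s hs => (B.effect_mem y s hs).1
  choose c hc hcB using hB
  have hb : 0 ≤ fun k => ∑ y, c y k := fun k => Finset.sum_nonneg fun y _ => hc y k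
  obtain ⟨w, hw, hwA, hwb⟩ := exists_joint_weights hm A hA (fun k => ∑ y, c y k) hb (by
    simp only [Finset.sum_smul]
    rw [Finset.sum_comm]
    simp only [hcB, B.sum_effect])
  have hBne : Nonempty B.Outcome := by
    by_contra hne
    rw [not_nonempty_iff] at hne
    have h := LinearMap.congr_fun B.sum_effect (polygonVertex (2 * m + 1) 0)
    rw [(polygon (2 * m + 1) (three_le_odd hm)).unit_apply _
      (polygonVertex_mem (three_le_odd hm) 0)] at h
    simp at h
  obtain ⟨y₀⟩ := hBne
  -- The conditional probability of the outcome `y` given `k`. Where the weight of `k` vanishes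
  -- the quotient is meaningless, and any probability vector will do.
  let ν : Fin (2 * m + 1) → B.Outcome → ℝ := fun k y =>
    if ∑ y, c y k = 0 then (if y = y₀ then 1 else 0) else c y k / ∑ y, c y k
  have hν : ∀ k y, 0 ≤ ν k y := by
    intro k y
    simp only [ν]
    split_ifs
    · exact zero_le_one
    · exact le_rfl
    · exact div_nonneg (hc y k) (hb k)
  have hν1 : ∀ k, ∑ y, ν k y = 1 := by
    intro k
    simp only [ν]
    split_ifs with h
    · simp
    · rw [← Finset.sum_div, div_self h]
  have hνc : ∀ k y, (∑ x, w x k) * ν k y = c y k := by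
    intro k y
    simp only [hwb, ν]
    split_ifs with h h'
    · rw [h, zero_mul, (Finset.sum_eq_zero_iff_of_nonneg fun y _ => hc y k).1 h y
        (Finset.mem_univ y)]
    · rw [h, zero_mul, (Finset.sum_eq_zero_iff_of_nonneg fun y _ => hc y k).1 h y
        (Finset.mem_univ y)]
    · field_simp
  refine ⟨Observable.ofNonneg (ι := A.Outcome × ULift (Fin (2 * m + 1)))
    (fun z => w z.1 z.2.down • g (2 * m + 1) z.2.down)
    (fun z s hs => mul_nonneg (hw _ _) (g_nonneg hm _ hs)) ?_, ?_, ?_⟩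
  · rw [Fintype.sum_prod_type, ← A.sum_effect]
    refine Finset.sum_congr rfl fun x _ => ?_
    rw [← hwA x, ← Equiv.ulift.symm.sum_comp]
    rfl
  · refine ⟨fun z x => if z.1 = x then 1 else 0, fun z x => ?_, fun z => ?_, fun x => ?_⟩
    · dsimp only
      split_ifs <;> norm_num
    · simp
    · change A.effect x = ∑ z : A.Outcome × ULift (Fin (2 * m + 1)),
        (if z.1 = x then (1 : ℝ) else 0) • w z.1 z.2.down • g (2 * m + 1) z.2.down
      rw [Fintype.sum_prod_type, Finset.sum_eq_single x, ← hwA x, ← Equiv.ulift.symm.sum_comp]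
      · simp
      · intro y _ hy
        simp [hy]
      · simp
  · refine ⟨fun z y => ν z.2.down y, fun z y => ⟨hν _ y, ?_⟩, fun z => hν1 _, fun y => ?_⟩
    · rw [← hν1 z.2.down]
      exact Finset.single_le_sum (f := fun y => ν z.2.down y) (fun y _ => hν _ y)
        (Finset.mem_univ y)
    · change B.effect y = ∑ z : A.Outcome × ULift (Fin (2 * m + 1)),
        ν z.2.down y • w z.1 z.2.down • g (2 * m + 1) z.2.down
      rw [Fintype.sum_prod_type, Finset.sum_comm, ← hcB y, ← Equiv.ulift.symm.sum_comp]
      refine Finset.sum_congr rfl fun k _ => ?_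
      rw [← hνc k y, Finset.sum_mul, Finset.sum_smul]
      refine Finset.sum_congr rfl fun x _ => ?_
      rw [smul_smul, mul_comm]
      rfl

end Observables

end GPT

theorem mainTheorem7 (m : ℕ) (hm : 1 ≤ m)
    (A : GPT.Observable.{u, 0} (GPT.polygon (2 * m + 1) (by omega))) :
    A ∈ GPT.T3 _ ↔
      ∀ x : A.Outcome, A.effect x ∈
        ⋂ i ∈ Set.Icc 1 (2 * m + 1),
          (PointedCone.hull ℝ
            {GPT.g (2 * m + 1) i, GPT.g (2 * m + 1) (i + m), GPT.g (2 * m + 1) (i + m + 1)} :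
            Set (Module.Dual ℝ (EuclideanSpace ℝ (Fin 3)))) := by
  simp only [Set.mem_iInter, SetLike.mem_coe]
  exact ⟨fun hA x i _ => GPT.effect_mem_hull_isosceles hm hA i x,
    GPT.mem_T3_of_effect_mem_hull_isosceles hm A⟩
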